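/- Theorem (Lower Bound on Convergence). For $k\ge 2$ let $Z_1,\dots,Z_k$ be i.i.d. $N(0,1)$, let $x_1=Z_1$ and $x_i=Z_i-Z_{i-1}$ for $2\le i\le k$, and let $y\in\{0,1\}$ satisfy $P(y=1\mid x)=\sigma\big(\sum_{j=1}^k x_j\big)=\sigma(Z_k)$, where $\sigma(t)=1/(1+e^{-t})$. For a predictor $p$ of the label from $x$, let $L(p)=-\mathbb{E}\,[\,y\log p(x)+(1-y)\log(1-p(x))\,]$ be its binary cross-entropy loss. Consider a path of agents $A_1\to A_2\to\cdots\to A_D$ in which $A_i$ observes the single feature $x_{\ell(i)}$ with $\ell(i)=((i-1)\bmod k)+1$. Agent $A_1$ outputs a logit $z_1(x)=w_1x_{\ell(1)}$, and for $i\ge 2$ agent $A_i$ outputs a logit $z_i(x)=w_i x_{\ell(i)}+v_i z_{i-1}(x)$, where the real weights $w_1$, respectively $w_i,v_i$, are chosen to minimize $L(\sigma(z_i))$ with the logit received from the predecessor held fixed. Let $p_i=\sigma(z_i)$ be the resulting predictors, and let $p^*(x)=\sigma(\theta^{*\top}x)$, where $\theta^*$ minimizes $L(\sigma(\theta^\top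 x))$ over all $\theta\in\mathbb{R}^k$. There is a universal constant $c>0$ such that for all $k\ge 2$ and all integers $p$ with $1\le p\le k-1$, with $D=kp$ (so that $A_D$ is the agent at the end of the $p$-th pass through the features): minimizing weights for all the agents $A_1,\dots,A_D$ and a global minimizer $\theta^*$ exist, and, for every choice of such minimizers, $$L(p_D)-L(p^*)\;\ge\;\frac{c}{p}\;=\;c\,\frac{k}{D}.$$ -/

import Mathlib

open MeasureTheory ProbabilityTheory

namespace NetLogistic

noncomputable section

/-! ### Logistic prediction and the sequential logit-passing protocol -/

/-- Expected binary cross-entropy loss `-E[y log p(x) + (1-y) log (1-p(x))]` of a predictor `p`,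
for a distribution `𝒟` of feature-label pairs `(x, y)`. -/
def bceLoss {d : ℕ} (𝒟 : Measure ((Fin d → ℝ) × ℝ)) (p : (Fin d → ℝ) → ℝ) : ℝ :=
  -∫ a, (a.2 * Real.log (p a.1) + (1 - a.2) * Real.log (1 - p a.1)) ∂𝒟

/-- The predictor `x ↦ σ(z(x))` with logit function `z`. -/
def predictor {d : ℕ} (z : (Fin d → ℝ) → ℝ) : (Fin d → ℝ) → ℝ :=
  fun x => Real.sigmoid (z x)

/-- The linear logit `x ↦ θᵀ x`. -/
def linearLogit {d : ℕ} (θ : Fin d → ℝ) : (Fin d → ℝ) → ℝ :=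
  fun x => ∑ l, θ l * x l

/-- `θ` minimizes the BCE loss over the full feature space, i.e. among all logistic predictors
that use all `d` features. -/
def IsGlobalOptimum {d : ℕ} (𝒟 : Measure ((Fin d → ℝ) × ℝ)) (θ : Fin d → ℝ) : Prop :=
  ∀ θ' : Fin d → ℝ,
    bceLoss 𝒟 (predictor (linearLogit θ)) ≤ bceLoss 𝒟 (predictor (linearLogit θ'))

/-- The logit functions available to an agent that observes the features in `S` and receives the
logits `z j` of its parents `j ∈ Pa`: all `x ↦ ∑_{l ∈ S} w l * x l + ∑_{j ∈ Pa} v j * z j x`. -/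
def availableLogits {d : ℕ} (S : Finset (Fin d)) (Pa : Finset ℕ) (z : ℕ → (Fin d → ℝ) → ℝ) :
    Set ((Fin d → ℝ) → ℝ) :=
  {f | ∃ (w : Fin d → ℝ) (v : ℕ → ℝ), ∀ x, f x = ∑ l ∈ S, w l * x l + ∑ j ∈ Pa, v j * z j x}

/-- `z 1, …, z N` are the logit functions produced by agents `1, …, N` (with observed feature sets
`S i` and parent sets `Pa i`): each agent's logit minimizes the BCE loss among those available to
it, given the logits of its parents. -/
def IsProtocolRun {d : ℕ} (𝒟 : Measure ((Fin d → ℝ) × ℝ)) (S : ℕ → Finset (Fin d))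
    (Pa : ℕ → Finset ℕ) (N : ℕ) (z : ℕ → (Fin d → ℝ) → ℝ) : Prop :=
  ∀ i, 1 ≤ i → i ≤ N →
    z i ∈ availableLogits (S i) (Pa i) z ∧
      ∀ f ∈ availableLogits (S i) (Pa i) z,
        bceLoss 𝒟 (predictor (z i)) ≤ bceLoss 𝒟 (predictor f)

/-! ### The network: a path with cyclic single-feature assignment -/

/-- Parent sets of the path `1 → 2 → 3 → ⋯`. -/
def pathParents (i : ℕ) : Finset ℕ := if i ≤ 1 then ∅ else {i - 1}

/-- Agent `i ≥ 1` observes the single feature number `((i - 1) mod k) + 1`; the features are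
indexed by `Fin k`, from zero. -/
def cyclicFeatures (k : ℕ) (hk : 0 < k) (i : ℕ) : Finset (Fin k) :=
  {⟨(i - 1) % k, Nat.mod_lt _ hk⟩}

/-! ### The data distribution -/

/-- Law of the latent variables: independent standard Gaussians `Z₁, …, Z_k`. -/
def latentLaw (k : ℕ) : Measure (Fin k → ℝ) :=
  Measure.pi fun _ => gaussianReal 0 1

/-- The features: `x₁ = Z₁` and `x_i = Z_i - Z_{i-1}` for `2 ≤ i ≤ k`. -/
def features {k : ℕ} (Z : Fin k → ℝ) : Fin k → ℝ :=
  fun i => if i.val = 0 then Z i else Z i - Z ⟨i.val - 1, lt_of_le_of_lt (Nat.sub_le _ _) i.isLt⟩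

/-- Prefix sums of the features recover the latent variables; in particular the sum of all
features is the last latent variable `Z_k`. -/
theorem sum_features_prefix {k : ℕ} (Z : Fin k → ℝ) (n : ℕ) (hn : n < k) :
    ∑ j ∈ Finset.Iic (⟨n, hn⟩ : Fin k), features Z j = Z ⟨n, hn⟩ := by
  induction n with
  | zero =>
    have : Finset.Iic (⟨0, hn⟩ : Fin k) = {⟨0, hn⟩} := by
      ext j; simp [Fin.le_def, Fin.ext_iff]
    simp [this, features]
  | succ n ih =>
    have h : Finset.Iic (⟨n + 1, hn⟩ : Fin k)
        = insert ⟨n + 1, hn⟩ (Finset.Iic (⟨n, by omega⟩ : Fin k)) := by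
      ext j; simp [Fin.le_def, Fin.ext_iff]; omega
    rw [h, Finset.sum_insert (by simp [Fin.le_def]), ih (by omega)]
    simp [features]

/-- Conditional law of the label `y ∈ {0, 1}` given the features:
`P(y = 1 | x) = σ(∑ j, x_j)`, which equals `σ(Z_k)`. -/
def labelKernel (k : ℕ) : Kernel (Fin k → ℝ) ℝ where
  toFun x := bernoulliMeasure (1 : ℝ) 0 (unitInterval.sigmoid (∑ j, x j))
  measurable' := by
    have hc : Measurable fun x : Fin k → ℝ => unitInterval.sigmoid (∑ j, x j) := by
      refine Measurable.subtype_mk ?_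
      exact continuous_sigmoid.measurable.comp (by fun_prop)
    refine Measure.measurable_of_measurable_coe _ fun s hs => ?_
    have h1 : Measurable fun p : unitInterval => bernoulliMeasure (1 : ℝ) 0 p s := by
      have ht : Measurable unitInterval.toNNReal := unitInterval.toNNReal_continuous.measurable
      have hσ : Measurable fun p : unitInterval => unitInterval.toNNReal (unitInterval.symm p) :=
        ht.comp unitInterval.continuous_symm.measurable
      simp only [bernoulliMeasure_def, Measure.add_apply, Measure.smul_apply]
      simp only [ENNReal.smul_def, smul_eq_mul]
      exact (ht.coe_nnreal_ennreal.mul_const _).add (hσ.coe_nnreal_ennreal.mul_const _)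
    exact h1.comp hc

instance (k : ℕ) : IsMarkovKernel (labelKernel k) :=
  ⟨fun x => inferInstanceAs
    (IsProbabilityMeasure (bernoulliMeasure (1 : ℝ) 0 (unitInterval.sigmoid (∑ j, x j))))⟩

/-- Joint law of the feature-label pair `(x, y)`. -/
def hardInstance (k : ℕ) : Measure ((Fin k → ℝ) × ℝ) :=
  ((latentLaw k).map features).compProd (labelKernel k)

theorem measurable_features {k : ℕ} : Measurable (features (k := k)) := by
  refine measurable_pi_iff.2 fun i => ?_
  unfold features
  split_ifs <;> fun_prop

instance (k : ℕ) : IsProbabilityMeasure (hardInstance k) := by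
  haveI : IsProbabilityMeasure (latentLaw k) := by unfold latentLaw; infer_instance
  haveI : IsProbabilityMeasure ((latentLaw k).map features) :=
    Measure.isProbabilityMeasure_map measurable_features.aemeasurable
  unfold hardInstance
  infer_instance

end

end NetLogistic

namespace NetLogistic

noncomputable section

/-! ### The symmetrized logistic loss -/

/-! A linear logit is `∑ j, a j * Z j` with `a = latentCoeff k θ`, hence a centred Gaussian of
standard deviation `‖a‖`. Since `Z` has independent centred coordinates and the label depends only
on the last one, the loss is `gaussianLoss ‖a‖ - signalStrength * a last` (`bceLoss_linearLogit`):
the norm is penalized and only the last coordinate is rewarded.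

Information moves slowly. A feature `m` other than the last involves only `Z (m - 1)` and `Z m`.
While the received logit has no weight on features up to `m + 1`, using feature `m` adds an
orthogonal vector with zero last coordinate, so it strictly raises the loss
(`optimal_weight_eq_zero`). As the features are visited in increasing order, nonzero weights spread
down from the last feature by at most one feature per pass.

After `p ≤ k - 1` passes, `a` therefore lives on the last `p + 1` coordinates and, the first weight
being zero, its coordinates sum to zero. By Cauchy–Schwarz, `a last` falls short of `‖a‖` by a
relative amount of order `1 / p` (`apply_le_of_sum_eq_zero`). The unrestricted model can realize
`‖a‖` times the last basis vector, and `exists_excess_lower_bound` turns the shortfall into excess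
loss.

Existence of minimizers comes from coercivity of this risk on every subspace
(`exists_latentRisk_min`). -/

/-- The even function `log (2 cosh (t / 2)) = log (1 + exp t) - t / 2`. -/
def logTwoCosh (t : ℝ) : ℝ := Real.log (2 * Real.cosh (t / 2))

theorem log_sigmoid (t : ℝ) : Real.log (Real.sigmoid t) = t / 2 - logTwoCosh t := by
  have h : Real.sigmoid t = Real.exp (t / 2) / (2 * Real.cosh (t / 2)) := by
    rw [Real.sigmoid_def, Real.cosh_eq, eq_div_iff (by positivity), inv_mul_eq_div,
      div_eq_iff (by positivity), mul_add, ← Real.exp_add]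
    ring_nf
  rw [h, Real.log_div (by positivity) (by positivity), Real.log_exp, logTwoCosh]

theorem logTwoCosh_neg (t : ℝ) : logTwoCosh (-t) = logTwoCosh t := by
  simp [logTwoCosh, neg_div]

theorem log_one_sub_sigmoid (t : ℝ) :
    Real.log (1 - Real.sigmoid t) = -(t / 2) - logTwoCosh t := by
  rw [← Real.sigmoid_neg, log_sigmoid, logTwoCosh_neg, neg_div]

theorem logTwoCosh_lt_logTwoCosh {s t : ℝ} (h : |s| < |t|) : logTwoCosh s < logTwoCosh t := by
  refine Real.log_lt_log (by positivity) ?_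
  have : Real.cosh (s / 2) < Real.cosh (t / 2) := by
    rw [Real.cosh_lt_cosh, abs_div, abs_div]
    gcongr
  linarith

theorem log_two_le_logTwoCosh (t : ℝ) : Real.log 2 ≤ logTwoCosh t :=
  Real.log_le_log (by norm_num) (by linarith [Real.one_le_cosh (t / 2)])

theorem abs_half_le_logTwoCosh (t : ℝ) : |t| / 2 ≤ logTwoCosh t := by
  wlog ht : 0 ≤ t generalizing t
  · simpa [logTwoCosh_neg] using this (-t) (by linarith)
  rw [abs_of_nonneg ht, logTwoCosh, Real.le_log_iff_exp_le (by positivity), Real.cosh_eq]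
  linarith [Real.exp_pos (-(t / 2))]

theorem logTwoCosh_le (t : ℝ) : logTwoCosh t ≤ |t| / 2 + Real.log 2 := by
  wlog ht : 0 ≤ t generalizing t
  · simpa [logTwoCosh_neg] using this (-t) (by linarith)
  rw [abs_of_nonneg ht, logTwoCosh, Real.log_le_iff_le_exp (by positivity), Real.exp_add,
    Real.exp_log (by norm_num), Real.cosh_eq]
  have : Real.exp (-(t / 2)) ≤ Real.exp (t / 2) := Real.exp_le_exp.2 (by linarith)
  linarith

theorem abs_logTwoCosh_le (t : ℝ) : |logTwoCosh t| ≤ |t| / 2 + Real.log 2 := by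
  rw [abs_of_nonneg ((Real.log_nonneg (by norm_num)).trans (log_two_le_logTwoCosh t))]
  exact logTwoCosh_le t

theorem continuous_logTwoCosh : Continuous logTwoCosh := by
  unfold logTwoCosh
  refine Continuous.log (by fun_prop) fun t => by positivity

theorem logTwoCosh_sub_eq_binEntropy (t : ℝ) :
    logTwoCosh t - (Real.sigmoid t - 1 / 2) * t = Real.binEntropy (Real.sigmoid t) := by
  rw [Real.binEntropy_eq_negMulLog_add_negMulLog_one_sub, Real.negMulLog, Real.negMulLog,
    log_sigmoid, log_one_sub_sigmoid]
  ring

theorem abs_sigmoid_sub_half_lt (t : ℝ) : |Real.sigmoid t - 1 / 2| < 1 / 2 := by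
  rw [abs_lt]
  constructor <;> linarith [Real.sigmoid_pos t, Real.sigmoid_lt_one t]

/-! ### Standard Gaussian expectations -/

theorem integrable_abs_gaussian : Integrable (fun x : ℝ => |x|) (gaussianReal 0 1) :=
  (IsGaussian.integrable_id (μ := gaussianReal 0 1)).abs

theorem integrable_of_abs_le_affine {Ω : Type*} [MeasurableSpace Ω] {μ : Measure Ω}
    [IsFiniteMeasure μ] {f g : Ω → ℝ} (hg : Integrable g μ) (hf : AEStronglyMeasurable f μ)
    (b : ℝ) (h : ∀ x, |f x| ≤ |g x| + b) : Integrable f μ :=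
  (hg.abs.add (integrable_const b)).mono' hf (.of_forall h)

/-- The excluded point `0` is null for the Gaussian, so `g - f` is positive almost everywhere. -/
theorem gaussian_integral_lt {f g : ℝ → ℝ} (hf : Integrable f (gaussianReal 0 1))
    (hg : Integrable g (gaussianReal 0 1)) (h : ∀ x, x ≠ 0 → f x < g x) :
    ∫ x, f x ∂gaussianReal 0 1 < ∫ x, g x ∂gaussianReal 0 1 := by
  have hna := nullSingletonClass_gaussianReal (μ := 0) (v := 1) one_ne_zero
  have h0 : ∀ᵐ x ∂gaussianReal 0 1, x ≠ 0 := by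
    rw [ae_iff]; simp
  have hi : Integrable (fun x => g x - f x) (gaussianReal 0 1) := hg.sub hf
  rw [← sub_pos, ← integral_sub hg hf, integral_pos_iff_support_of_nonneg_ae _ hi]
  · have : ∀ᵐ x ∂gaussianReal 0 1, x ∈ Function.support fun x => g x - f x := by
      filter_upwards [h0] with x hx
      exact (sub_pos.2 (h x hx)).ne'
    rw [measure_congr (s := Function.support fun x => g x - f x)
      (Filter.eventuallyEq_univ.2 this)]
    simp
  · filter_upwards [h0] with x hx
    exact (sub_pos.2 (h x hx)).le

/-- The expectation of `log (2 cosh (s G / 2))` for a standard Gaussian `G`. -/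
def gaussianLoss (s : ℝ) : ℝ := ∫ x, logTwoCosh (s * x) ∂gaussianReal 0 1

/-- The correlation `E[(σ(G) - 1/2) G]` for a standard Gaussian `G`. -/
def signalStrength : ℝ := ∫ x, (Real.sigmoid x - 1 / 2) * x ∂gaussianReal 0 1

theorem integrable_logTwoCosh_comp {Ω : Type*} [MeasurableSpace Ω] {μ : Measure Ω}
    [IsFiniteMeasure μ] {g : Ω → ℝ} (hg : Integrable g μ) :
    Integrable (fun x => logTwoCosh (g x)) μ :=
  integrable_of_abs_le_affine hg
    (continuous_logTwoCosh.comp_aestronglyMeasurable hg.aestronglyMeasurable) (Real.log 2)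
    fun x => (abs_logTwoCosh_le _).trans (by linarith [abs_nonneg (g x)])

theorem integrable_sigmoid_sub_half_mul {Ω : Type*} [MeasurableSpace Ω] {μ : Measure Ω}
    [IsFiniteMeasure μ] {f g : Ω → ℝ} (hf : AEStronglyMeasurable f μ) (hg : Integrable g μ) :
    Integrable (fun x => (Real.sigmoid (f x) - 1 / 2) * g x) μ := by
  refine hg.bdd_mul (c := 1 / 2)
    ((continuous_sigmoid.comp_aestronglyMeasurable hf).sub aestronglyMeasurable_const)
    (.of_forall fun x => (abs_sigmoid_sub_half_lt _).le)

theorem integrable_const_mul_gaussian (s : ℝ) :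
    Integrable (fun x : ℝ => s * x) (gaussianReal 0 1) :=
  (IsGaussian.integrable_id (μ := gaussianReal 0 1)).const_mul s

theorem integrable_signal :
    Integrable (fun x : ℝ => (Real.sigmoid x - 1 / 2) * x) (gaussianReal 0 1) :=
  integrable_sigmoid_sub_half_mul aestronglyMeasurable_id IsGaussian.integrable_id

theorem gaussianLoss_lt {s t : ℝ} (hs : 0 ≤ s) (hst : s < t) :
    gaussianLoss s < gaussianLoss t := by
  refine gaussian_integral_lt (integrable_logTwoCosh_comp (integrable_const_mul_gaussian s))
    (integrable_logTwoCosh_comp (integrable_const_mul_gaussian t)) fun x hx =>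
    logTwoCosh_lt_logTwoCosh ?_
  rw [abs_mul, abs_mul, abs_of_nonneg hs, abs_of_nonneg (hs.trans hst.le)]
  exact mul_lt_mul_of_pos_right hst (abs_pos.2 hx)

theorem log_two_le_gaussianLoss (s : ℝ) : Real.log 2 ≤ gaussianLoss s := by
  have := integral_mono (μ := gaussianReal 0 1) (integrable_const (Real.log 2))
    (integrable_logTwoCosh_comp (integrable_const_mul_gaussian s))
    fun x => log_two_le_logTwoCosh (s * x)
  simpa [gaussianLoss] using this

theorem continuous_gaussianLoss : Continuous gaussianLoss := by
  refine continuous_iff_continuousAt.2 fun s₀ => ?_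
  refine continuousAt_of_dominated (bound := fun x => (|s₀| + 1) * |x| + Real.log 2)
    (.of_forall fun s =>
      (integrable_logTwoCosh_comp (integrable_const_mul_gaussian s)).aestronglyMeasurable)
    ?_ ((integrable_abs_gaussian.const_mul _).add (integrable_const _))
    (.of_forall fun x => ?_)
  · filter_upwards [Metric.ball_mem_nhds s₀ one_pos] with s hs
    refine .of_forall fun x => (abs_logTwoCosh_le _).trans ?_
    have h1 : |s| ≤ |s₀| + 1 := by
      have := abs_sub_abs_le_abs_sub s s₀
      rw [Metric.mem_ball, Real.dist_eq] at hs
      linarith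
    have h2 : |s * x| ≤ (|s₀| + 1) * |x| := by
      rw [abs_mul]
      gcongr
    linarith [abs_nonneg (s * x)]
  · exact (continuous_logTwoCosh.comp (by fun_prop)).continuousAt

theorem signalStrength_pos : 0 < signalStrength := by
  have := gaussian_integral_lt (f := fun _ => 0) (integrable_const 0) integrable_signal ?_
  · simpa [signalStrength] using this
  · intro x hx
    have h0 : Real.sigmoid 0 = 1 / 2 := by simp
    rcases hx.lt_or_gt with h | h
    · have := Real.sigmoid_lt h
      exact mul_pos_of_neg_of_neg (by linarith) h
    · have := Real.sigmoid_lt h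
      exact mul_pos (by linarith) h

theorem signalStrength_lt : signalStrength < (∫ x, |x| ∂gaussianReal 0 1) / 2 := by
  rw [← integral_div]
  refine gaussian_integral_lt integrable_signal (integrable_abs_gaussian.div_const 2) fun x hx => ?_
  calc (Real.sigmoid x - 1 / 2) * x ≤ |(Real.sigmoid x - 1 / 2) * x| := le_abs_self _
    _ = |Real.sigmoid x - 1 / 2| * |x| := abs_mul _ _
    _ < 1 / 2 * |x| := mul_lt_mul_of_pos_right (abs_sigmoid_sub_half_lt x) (abs_pos.2 hx)
    _ = |x| / 2 := by ring

/-- Linear growth of the one-dimensional risk. -/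
theorem exists_linear_growth :
    ∃ κ : ℝ, 0 < κ ∧ ∀ s, 0 ≤ s → κ * s ≤ gaussianLoss s - signalStrength * s := by
  -- Here `κ = E|G| / 2 - signalStrength`, from `logTwoCosh t ≥ |t| / 2`.
  refine ⟨_, sub_pos.2 signalStrength_lt, fun s hs => ?_⟩
  have h := integral_mono (μ := gaussianReal 0 1) (integrable_abs_gaussian.const_mul (s / 2))
    (integrable_logTwoCosh_comp (integrable_const_mul_gaussian s)) fun x => by
      have := abs_half_le_logTwoCosh (s * x)
      rw [abs_mul, abs_of_nonneg hs] at this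
      linarith
  rw [integral_const_mul] at h
  change _ ≤ gaussianLoss s at h
  linarith

/-- With the true logit the loss is the expected entropy of the label, and that entropy is below
`log 2` except at `x = 0`. This is the constant gap over the uninformative predictor. -/
theorem gaussianLoss_one_sub_lt : gaussianLoss 1 - signalStrength < Real.log 2 := by
  have h1 := integrable_logTwoCosh_comp (integrable_const_mul_gaussian 1)
  have := gaussian_integral_lt (h1.sub integrable_signal) (integrable_const (Real.log 2))
    fun x hx => by
      have h2 : Real.binEntropy (Real.sigmoid x) < Real.log 2 := by
        rw [Real.binEntropy_lt_log_two, ← Real.sigmoid_zero]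
        exact fun h => hx (Real.sigmoid_injective h)
      rw [← logTwoCosh_sub_eq_binEntropy] at h2
      simpa using h2
  simp only [Pi.sub_apply] at this
  rw [integral_sub h1 integrable_signal] at this
  simpa [gaussianLoss, signalStrength] using this

/-- Weakening the correlation of the logit with the signal by a relative amount `η` costs a
positive multiple of `η`, relative to the best rescaling of the signal. -/
theorem exists_excess_lower_bound :
    ∃ δ : ℝ, 0 < δ ∧ ∀ η L s c : ℝ, 0 ≤ s → 0 ≤ η → η ≤ 1 → c ≤ s * (1 - η) →
      (∀ t, 0 ≤ t → L ≤ gaussianLoss t - signalStrength * t) →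
      δ * η ≤ gaussianLoss s - signalStrength * c - L := by
  set δ := Real.log 2 - (gaussianLoss 1 - signalStrength) with hδ
  have hδ0 : 0 < δ := sub_pos.2 gaussianLoss_one_sub_lt
  refine ⟨δ / 2, by positivity, fun η L s c hs hη hη1 hc hL => ?_⟩
  have hμ := signalStrength_pos
  have hc' := mul_le_mul_of_nonneg_left hc hμ.le
  have hsη := mul_nonneg (mul_nonneg hμ.le hs) hη
  -- A small `s` gains at most `δ / 2` over `log 2`, while `t = 1` gains `δ`. For larger `s`,
  -- comparison with `t = s` leaves a deficit of at least `signalStrength * s * η`.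
  rcases le_total (signalStrength * s) (δ / 2) with h | h
  · have h1 := hL 1 zero_le_one
    have h2 := log_two_le_gaussianLoss s
    have h3 : δ / 2 * η ≤ δ / 2 := mul_le_of_le_one_right (by positivity) hη1
    nlinarith
  · have h1 := hL s hs
    have h2 := mul_le_mul_of_nonneg_right h hη
    nlinarith

/-! ### The risk of a linear logit -/

instance (k : ℕ) : IsProbabilityMeasure (latentLaw k) := by
  unfold latentLaw; infer_instance

/-- The coefficients, in terms of the latent variables, of the linear logit with weights `θ`. -/
def latentCoeff (k : ℕ) : (Fin k → ℝ) →ₗ[ℝ] EuclideanSpace ℝ (Fin k) where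
  toFun θ := WithLp.toLp 2 fun j => θ j - if h : j.val + 1 < k then θ ⟨j.val + 1, h⟩ else 0
  map_add' θ θ' := by
    ext j
    simp only [PiLp.add_apply, Pi.add_apply]
    split_ifs <;> ring
  map_smul' c θ := by
    ext j
    simp only [PiLp.smul_apply, Pi.smul_apply, smul_eq_mul, RingHom.id_apply]
    split_ifs <;> ring

theorem latentCoeff_apply {k : ℕ} (θ : Fin k → ℝ) (j : Fin k) :
    latentCoeff k θ j = θ j - if h : j.val + 1 < k then θ ⟨j.val + 1, h⟩ else 0 := rfl

/-- Summation by parts: `Z j` enters feature `j` with sign `+` and feature `j + 1` with sign `-`. -/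
theorem linearLogit_features {k : ℕ} (θ Z : Fin k → ℝ) :
    linearLogit θ (features Z) = ∑ j, latentCoeff k θ j * Z j := by
  cases k with
  | zero => simp [linearLogit]
  | succ n =>
    have h1 : ∑ j, θ j * Z j = ∑ i : Fin n, θ i.castSucc * Z i.castSucc
        + θ (Fin.last n) * Z (Fin.last n) := Fin.sum_univ_castSucc _
    rw [Fin.sum_univ_succ] at h1
    rw [linearLogit, Fin.sum_univ_succ, Fin.sum_univ_castSucc]
    have h2 : ∀ i : Fin n, θ i.succ * features Z i.succ
        = θ i.succ * Z i.succ - θ i.succ * Z i.castSucc := by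
      intro i
      simp only [features, Fin.val_succ, Nat.add_eq_zero_iff, one_ne_zero, and_false, if_false,
        Nat.add_sub_cancel, mul_sub]
      rfl
    have h3 : ∀ i : Fin n, latentCoeff (n + 1) θ i.castSucc * Z i.castSucc
        = θ i.castSucc * Z i.castSucc - θ i.succ * Z i.castSucc := by
      intro i
      rw [latentCoeff_apply, dif_pos (by simp), sub_mul]
      rfl
    have h4 : latentCoeff (n + 1) θ (Fin.last n) = θ (Fin.last n) := by
      simp [latentCoeff_apply]
    simp only [h2, h3, h4, Finset.sum_sub_distrib]
    simp only [features, Fin.val_zero, if_true]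
    linarith

/-- Evaluating the logit at `Z = 1` kills every feature but the first. This gives the zero-sum
constraint whenever the first weight vanishes. -/
theorem sum_latentCoeff {k : ℕ} (hk : 0 < k) (θ : Fin k → ℝ) :
    ∑ j, latentCoeff k θ j = θ ⟨0, hk⟩ := by
  have h := linearLogit_features θ fun _ => 1
  simp only [mul_one] at h
  rw [← h, linearLogit, Finset.sum_eq_single ⟨0, hk⟩]
  · simp [features]
  · intro j _ hj
    have : j.val ≠ 0 := fun h0 => hj (Fin.ext h0)
    simp [features, this]
  · simp

theorem sum_features {k : ℕ} (hk : 0 < k) (Z : Fin k → ℝ) :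
    ∑ j, features Z j = Z ⟨k - 1, by omega⟩ := by
  rw [← sum_features_prefix Z (k - 1) (by omega)]
  refine Finset.sum_congr ?_ fun _ _ => rfl
  ext j
  simp only [Finset.mem_univ, Finset.mem_Iic, Fin.le_def, true_iff]
  omega

theorem integral_labelKernel {k : ℕ} (x : Fin k → ℝ) (g : ℝ → ℝ) :
    ∫ y, g y ∂labelKernel k x
      = Real.sigmoid (∑ j, x j) * g 1 + (1 - Real.sigmoid (∑ j, x j)) * g 0 := by
  change ∫ y, g y ∂bernoulliMeasure (1 : ℝ) 0 (unitInterval.sigmoid (∑ j, x j)) = _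
  rw [integral_bernoulliMeasure]
  rfl

theorem integrable_labelKernel {k : ℕ} (x : Fin k → ℝ) (g : ℝ → ℝ) :
    Integrable g (labelKernel k x) :=
  integrable_bernoulliMeasure _ _ _ _

theorem integrable_latent {k : ℕ} (j : Fin k) :
    Integrable (fun Z : Fin k → ℝ => Z j) (latentLaw k) :=
  integrable_eval (μ := fun _ : Fin k => gaussianReal 0 1) IsGaussian.integrable_id

theorem integrable_latent_sum {k : ℕ} (a : Fin k → ℝ) :
    Integrable (fun Z : Fin k → ℝ => ∑ j, a j * Z j) (latentLaw k) :=
  integrable_finsetSum _ fun j _ => (integrable_latent j).const_mul (a j)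

theorem aemeasurable_latent_sum {k : ℕ} (a : Fin k → ℝ) :
    AEMeasurable (fun Z : Fin k → ℝ => ∑ j, a j * Z j) (latentLaw k) :=
  (integrable_latent_sum a).aestronglyMeasurable.aemeasurable

theorem continuous_linearLogit {k : ℕ} (θ : Fin k → ℝ) : Continuous (linearLogit θ) := by
  unfold linearLogit; fun_prop

theorem integrable_linearLogit {k : ℕ} (θ : Fin k → ℝ) :
    Integrable (linearLogit θ) ((latentLaw k).map features) := by
  rw [integrable_map_measure (continuous_linearLogit θ).aestronglyMeasurable
    measurable_features.aemeasurable]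
  have : linearLogit θ ∘ features = fun Z => ∑ j, latentCoeff k θ j * Z j :=
    funext fun Z => linearLogit_features θ Z
  rw [this]
  exact integrable_latent_sum _

instance (k : ℕ) : IsProbabilityMeasure ((latentLaw k).map features) :=
  Measure.isProbabilityMeasure_map measurable_features.aemeasurable

/-- Pointwise the loss is `logTwoCosh z - (y - 1 / 2) * z`; averaging over the label replaces `y` by
`σ` of the last latent variable. -/
theorem bceLoss_linearLogit_eq_integral {k : ℕ} (hk : 0 < k) (θ : Fin k → ℝ) :
    bceLoss (hardInstance k) (predictor (linearLogit θ))
      = ∫ Z, (logTwoCosh (∑ j, latentCoeff k θ j * Z j)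
          - (Real.sigmoid (Z ⟨k - 1, by omega⟩) - 1 / 2) * ∑ j, latentCoeff k θ j * Z j)
        ∂latentLaw k := by
  have hz := integrable_linearLogit θ
  have hc := continuous_linearLogit θ
  have hform : ∀ a : (Fin k → ℝ) × ℝ,
      a.2 * Real.log (predictor (linearLogit θ) a.1)
          + (1 - a.2) * Real.log (1 - predictor (linearLogit θ) a.1)
        = (a.2 - 1 / 2) * linearLogit θ a.1 - logTwoCosh (linearLogit θ a.1) := by
    intro a
    rw [predictor, log_sigmoid, log_one_sub_sigmoid]
    ring
  have hm : Continuous fun a : (Fin k → ℝ) × ℝ =>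
      (a.2 - 1 / 2) * linearLogit θ a.1 - logTwoCosh (linearLogit θ a.1) :=
    ((continuous_snd.sub continuous_const).mul (hc.comp continuous_fst)).sub
      (continuous_logTwoCosh.comp (hc.comp continuous_fst))
  have hint : Integrable (fun a : (Fin k → ℝ) × ℝ =>
      (a.2 - 1 / 2) * linearLogit θ a.1 - logTwoCosh (linearLogit θ a.1))
      (((latentLaw k).map features).compProd (labelKernel k)) := by
    rw [Measure.integrable_compProd_iff hm.aestronglyMeasurable]
    refine ⟨.of_forall fun x => integrable_labelKernel x _, ?_⟩
    refine integrable_of_abs_le_affine (hz.const_mul 2)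
      hm.norm.stronglyMeasurable.integral_kernel_prod_right'.aestronglyMeasurable (Real.log 2)
      fun x => ?_
    rw [integral_labelKernel, abs_of_nonneg (by
      have h1 := Real.sigmoid_pos (∑ j, x j)
      have h2 := sub_pos.2 (Real.sigmoid_lt_one (∑ j, x j))
      positivity)]
    have hl := abs_logTwoCosh_le (linearLogit θ x)
    have hb : ∀ y : ℝ, |y - 1 / 2| = 1 / 2 →
        ‖(y - 1 / 2) * linearLogit θ x - logTwoCosh (linearLogit θ x)‖
          ≤ |2 * linearLogit θ x| + Real.log 2 := by
      intro y hy
      rw [Real.norm_eq_abs]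
      refine (abs_sub _ _).trans ?_
      rw [abs_mul, hy, abs_mul, abs_two]
      linarith [abs_nonneg (linearLogit θ x)]
    have h1 := hb 1 (by rw [abs_of_pos] <;> norm_num)
    have h0 := hb 0 (by rw [abs_of_neg] <;> norm_num)
    have hs := Real.sigmoid_pos (∑ j, x j)
    have hs' := sub_pos.2 (Real.sigmoid_lt_one (∑ j, x j))
    nlinarith [mul_le_mul_of_nonneg_left h1 hs.le, mul_le_mul_of_nonneg_left h0 hs'.le]
  rw [bceLoss, hardInstance]
  simp only [hform]
  rw [Measure.integral_compProd hint]
  simp only [integral_labelKernel]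
  rw [← integral_neg, integral_map measurable_features.aemeasurable]
  · refine integral_congr_ae (.of_forall fun Z => ?_)
    simp only [sum_features hk, linearLogit_features]
    ring
  · refine Continuous.aestronglyMeasurable ?_
    have := continuous_sigmoid
    have := continuous_logTwoCosh
    fun_prop

theorem map_latent_sum {k : ℕ} (a : EuclideanSpace ℝ (Fin k)) :
    (latentLaw k).map (fun Z => ∑ j, a j * Z j)
      = (gaussianReal 0 1).map fun x => ‖a‖ * x := by
  have := Measure.isProbabilityMeasure_map (μ := latentLaw k)
    (f := fun Z => ∑ j, a j * Z j) (aemeasurable_latent_sum a)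
  have := Measure.isProbabilityMeasure_map (μ := gaussianReal 0 1)
    (f := fun x => ‖a‖ * x) (by fun_prop)
  refine Measure.ext_of_charFun (funext fun t => ?_)
  rw [gaussianReal_map_const_mul, charFun_gaussianReal, charFun_apply_real,
    integral_map (aemeasurable_latent_sum a) (by fun_prop), latentLaw]
  have h : ∀ Z : Fin k → ℝ, Complex.exp (t * ((∑ j, a j * Z j : ℝ) : ℂ) * Complex.I)
      = ∏ j, Complex.exp (((t * a j : ℝ) : ℂ) * (Z j : ℂ) * Complex.I) := by
    intro Z
    rw [← Complex.exp_sum, Complex.ofReal_sum, Finset.mul_sum, Finset.sum_mul]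
    congr 1
    refine Finset.sum_congr rfl fun j _ => ?_
    push_cast
    ring
  simp only [h]
  rw [integral_fintype_prod_eq_prod
    (f := fun j (x : ℝ) => Complex.exp (((t * a j : ℝ) : ℂ) * (x : ℂ) * Complex.I))]
  simp only [← charFun_apply_real, charFun_gaussianReal]
  rw [← Complex.exp_sum]
  congr 1
  have hn : ((‖a‖ ^ 2 : ℝ) : ℂ) = ∑ j, ((a j : ℝ) : ℂ) ^ 2 := by
    rw [EuclideanSpace.real_norm_sq_eq]; push_cast; rfl
  push_cast at hn ⊢
  simp only [mul_zero, zero_mul, zero_sub, one_mul,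
    Finset.sum_neg_distrib]
  rw [← Finset.sum_div]
  simp only [mul_pow, ← Finset.mul_sum, ← hn]
  ring

theorem integral_latent_comp {k : ℕ} (j : Fin k) {f : ℝ → ℝ} (hf : Continuous f) :
    ∫ Z, f (Z j) ∂latentLaw k = ∫ x, f x ∂gaussianReal 0 1 :=
  integral_comp_eval (μ := fun _ : Fin k => gaussianReal 0 1) hf.aestronglyMeasurable

theorem integral_signal_mul {k : ℕ} (i j : Fin k) :
    ∫ Z, (Real.sigmoid (Z i) - 1 / 2) * Z j ∂latentLaw k
      = if j = i then signalStrength else 0 := by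
  split_ifs with h
  · subst h
    exact integral_latent_comp j (f := fun x => (Real.sigmoid x - 1 / 2) * x)
      ((continuous_sigmoid.sub continuous_const).mul continuous_id)
  · have hI : iIndepFun (fun (i : Fin k) (Z : Fin k → ℝ) => Z i) (latentLaw k) :=
      iIndepFun_pi (μ := fun _ : Fin k => gaussianReal 0 1) (X := fun _ x => x)
        fun _ => aemeasurable_id
    have hI2 := (hI.indepFun (Ne.symm h)).comp (φ := fun x => Real.sigmoid x - 1 / 2)
      (continuous_sigmoid.measurable.sub_const _) measurable_id
    have := hI2.integral_fun_mul_eq_mul_integral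
      ((continuous_sigmoid.comp (continuous_apply i)).sub continuous_const).aestronglyMeasurable
      (continuous_apply j).aestronglyMeasurable
    have h0 : ∫ Z, Z j ∂latentLaw k = 0 := by
      have := integral_latent_comp j continuous_id
      simpa using this
    simpa [h0] using this

/-- The logistic risk as a function of the latent coefficients. -/
def latentRisk {k : ℕ} (last : Fin k) (a : EuclideanSpace ℝ (Fin k)) : ℝ :=
  gaussianLoss ‖a‖ - signalStrength * a last

theorem integral_eq_latentRisk {k : ℕ} (i : Fin k) (a : EuclideanSpace ℝ (Fin k)) :
    ∫ Z, (logTwoCosh (∑ j, a j * Z j) - (Real.sigmoid (Z i) - 1 / 2) * ∑ j, a j * Z j)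
      ∂latentLaw k = latentRisk i a := by
  have hi : AEStronglyMeasurable (fun Z : Fin k → ℝ => Z i) (latentLaw k) :=
    (continuous_apply i).aestronglyMeasurable
  rw [integral_sub (integrable_logTwoCosh_comp (integrable_latent_sum _))
    (integrable_sigmoid_sub_half_mul hi (integrable_latent_sum _)), latentRisk]
  congr 1
  · rw [gaussianLoss, ← integral_map (φ := fun Z : Fin k → ℝ => ∑ j, a j * Z j) (f := logTwoCosh)
        (aemeasurable_latent_sum a) continuous_logTwoCosh.aestronglyMeasurable, map_latent_sum,
      integral_map (by fun_prop) continuous_logTwoCosh.aestronglyMeasurable]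
  · have h : ∀ Z : Fin k → ℝ, (Real.sigmoid (Z i) - 1 / 2) * ∑ j, a j * Z j
        = ∑ j, a j * ((Real.sigmoid (Z i) - 1 / 2) * Z j) := fun Z => by
      rw [Finset.mul_sum]
      exact Finset.sum_congr rfl fun j _ => by ring
    simp only [h]
    rw [integral_finsetSum _ fun j _ => (integrable_sigmoid_sub_half_mul
      hi (integrable_latent j)).const_mul (a j)]
    simp only [integral_const_mul, integral_signal_mul]
    simp [mul_comm]

theorem bceLoss_linearLogit {k : ℕ} (hk : 0 < k) (θ : Fin k → ℝ) :
    bceLoss (hardInstance k) (predictor (linearLogit θ))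
      = latentRisk ⟨k - 1, by omega⟩ (latentCoeff k θ) := by
  rw [bceLoss_linearLogit_eq_integral hk, integral_eq_latentRisk]

/-- The risk is continuous and, since a coordinate is at most the norm, grows at least like `κ *
‖a‖`. Allowing any subspace covers both the global problem and that of a single agent. -/
theorem exists_latentRisk_min {k : ℕ} (last : Fin k)
    (V : Submodule ℝ (EuclideanSpace ℝ (Fin k))) :
    ∃ a ∈ V, ∀ b ∈ V, latentRisk last a ≤ latentRisk last b := by
  have hcont : Continuous fun a : V => latentRisk last (a : EuclideanSpace ℝ (Fin k)) := by
    have := continuous_gaussianLoss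
    unfold latentRisk
    fun_prop
  obtain ⟨κ, hκ, h⟩ := exists_linear_growth
  have htend : Filter.Tendsto (fun a : V => latentRisk last (a : EuclideanSpace ℝ (Fin k)))
      (Filter.cocompact V) Filter.atTop := by
    refine Filter.tendsto_atTop_mono (fun a => ?_)
      ((tendsto_norm_cocompact_atTop (E := V)).const_mul_atTop hκ)
    have h1 := h ‖a‖ (norm_nonneg a)
    have h2 : (a : EuclideanSpace ℝ (Fin k)) last ≤ ‖a‖ :=
      (le_abs_self _).trans (PiLp.norm_apply_le (a : EuclideanSpace ℝ (Fin k)) last)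
    have h3 := mul_le_mul_of_nonneg_left h2 signalStrength_pos.le
    rw [latentRisk, Submodule.coe_norm]
    rw [Submodule.coe_norm] at h1 h3
    linarith
  obtain ⟨a, ha⟩ := hcont.exists_forall_le htend
  exact ⟨a, a.2, fun b hb => ha ⟨b, hb⟩⟩

/-! ### Runs of the protocol along the cyclic path -/

theorem linearLogit_single {k : ℕ} (m : Fin k) (x : Fin k → ℝ) :
    linearLogit (Pi.single m 1) x = x m := by
  simp [linearLogit, Pi.single_apply]

theorem linearLogit_add_smul {k : ℕ} (w v : ℝ) (θ θ' : Fin k → ℝ) (x : Fin k → ℝ) :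
    linearLogit (w • θ + v • θ') x = w * linearLogit θ x + v * linearLogit θ' x := by
  simp only [linearLogit, Finset.mul_sum, ← Finset.sum_add_distrib, Pi.add_apply, Pi.smul_apply,
    smul_eq_mul]
  exact Finset.sum_congr rfl fun j _ => by ring

/-- Agent `i + 1` on the path chooses among the linear logits spanned by its feature and the
weights received from agent `i` (which are zero if there is no such agent). -/
theorem mem_availableLogits_path {k : ℕ} (hk : 0 < k) (i : ℕ) (z : ℕ → (Fin k → ℝ) → ℝ)
    (θ : Fin k → ℝ) (h0 : i = 0 → θ = 0) (h1 : 1 ≤ i → z i = linearLogit θ)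
    (f : (Fin k → ℝ) → ℝ) :
    f ∈ availableLogits (cyclicFeatures k hk (i + 1)) (pathParents (i + 1)) z ↔
      ∃ w v : ℝ, f = linearLogit
        (w • Pi.single (⟨i % k, Nat.mod_lt _ hk⟩ : Fin k) (1 : ℝ) + v • θ) := by
  simp only [availableLogits, cyclicFeatures, Nat.add_sub_cancel, Finset.sum_singleton,
    Set.mem_ofPred_eq, funext_iff, linearLogit_add_smul, linearLogit_single]
  rcases Nat.eq_zero_or_pos i with hi | hi
  · have : linearLogit (0 : Fin k → ℝ) = fun _ => 0 := by ext x; simp [linearLogit]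
    rw [h0 hi, this]
    simp only [hi, pathParents, zero_add, le_refl, if_true, Finset.sum_empty, add_zero, mul_zero]
    exact ⟨fun ⟨w, _, h⟩ => ⟨_, 0, h⟩, fun ⟨w, _, h⟩ => ⟨fun _ => w, 0, h⟩⟩
  · have hp : pathParents (i + 1) = {i} := by
      rw [pathParents, if_neg (by omega), Nat.add_sub_cancel]
    simp only [hp, Finset.sum_singleton, h1 hi]
    exact ⟨fun ⟨w, v, h⟩ => ⟨_, _, h⟩, fun ⟨w, v, h⟩ => ⟨fun _ => w, fun _ => v, h⟩⟩

theorem exists_isGlobalOptimum {k : ℕ} (hk : 0 < k) :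
    ∃ θ : Fin k → ℝ, IsGlobalOptimum (hardInstance k) θ := by
  obtain ⟨a, ⟨θ, rfl⟩, h⟩ :=
    exists_latentRisk_min ⟨k - 1, by omega⟩ (LinearMap.range (latentCoeff k))
  refine ⟨θ, fun θ' => ?_⟩
  rw [bceLoss_linearLogit hk, bceLoss_linearLogit hk]
  exact h _ ⟨θ', rfl⟩

/-- Minimizing over the span rather than over `(w, v)` avoids losing coercivity when the two vectors
are dependent, as for the first agent, where `θ₂ = 0`. -/
theorem exists_optimal_pair {k : ℕ} (hk : 0 < k) (θ₁ θ₂ : Fin k → ℝ) :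
    ∃ w v : ℝ, ∀ w' v' : ℝ,
      bceLoss (hardInstance k) (predictor (linearLogit (w • θ₁ + v • θ₂)))
        ≤ bceLoss (hardInstance k) (predictor (linearLogit (w' • θ₁ + v' • θ₂))) := by
  obtain ⟨a, ha, h⟩ := exists_latentRisk_min ⟨k - 1, by omega⟩
    (Submodule.span ℝ {latentCoeff k θ₁, latentCoeff k θ₂})
  obtain ⟨w, v, rfl⟩ := Submodule.mem_span_pair.1 ha
  refine ⟨w, v, fun w' v' => ?_⟩
  rw [bceLoss_linearLogit hk, bceLoss_linearLogit hk]
  simpa only [map_add, map_smul] using h _ (Submodule.mem_span_pair.2 ⟨w', v', rfl⟩)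

theorem exists_isProtocolRun {k : ℕ} (hk : 0 < k) (N : ℕ) :
    ∃ z : ℕ → (Fin k → ℝ) → ℝ,
      IsProtocolRun (hardInstance k) (cyclicFeatures k hk) pathParents N z := by
  choose W V hWV using exists_optimal_pair hk
  let e : ℕ → Fin k → ℝ := fun i => Pi.single ⟨i % k, Nat.mod_lt _ hk⟩ 1
  -- The zero start stands for the missing predecessor of the first agent.
  let θ : ℕ → Fin k → ℝ := fun i => Nat.rec 0 (fun i t => W (e i) t • e i + V (e i) t • t) i
  refine ⟨fun i => linearLogit (θ i), fun i hi _ => ?_⟩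
  obtain ⟨i, rfl⟩ := Nat.exists_eq_add_of_le' hi
  have hav := mem_availableLogits_path hk i (fun i => linearLogit (θ i)) (θ i)
    (fun h => by subst h; rfl) (fun _ => rfl)
  refine ⟨(hav _).2 ⟨W (e i) (θ i), V (e i) (θ i), rfl⟩, fun f hf => ?_⟩
  obtain ⟨w, v, rfl⟩ := (hav f).1 hf
  exact hWV (e i) (θ i) w v

/-! ### Features that carry no information yet receive no weight -/

theorem latentCoeff_single_ne_zero {k : ℕ} (m : Fin k) :
    latentCoeff k (Pi.single m 1) ≠ 0 := by
  intro h
  have := congrArg (fun a => a m) h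
  simp only [latentCoeff_apply, Pi.single_eq_same, PiLp.zero_apply] at this
  split_ifs at this with h'
  · rw [Pi.single_eq_of_ne (by simp [Fin.ext_iff])] at this
    norm_num at this
  · norm_num at this

theorem latentCoeff_single_eq_zero {k : ℕ} (m j : Fin k) (hj : m.val < j.val) :
    latentCoeff k (Pi.single m 1) j = 0 := by
  rw [latentCoeff_apply, Pi.single_eq_of_ne (by simp [Fin.ext_iff]; omega)]
  split_ifs with h
  · rw [Pi.single_eq_of_ne (by simp [Fin.ext_iff]; omega), sub_zero]
  · simp

theorem latentCoeff_eq_zero {k n : ℕ} {θ : Fin k → ℝ} (hθ : ∀ l : Fin k, l.val ≤ n → θ l = 0)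
    (j : Fin k) (hj : j.val < n) : latentCoeff k θ j = 0 := by
  rw [latentCoeff_apply, hθ j hj.le]
  split_ifs with h
  · rw [hθ _ (by simpa using hj), sub_zero]
  · simp

/-- If the received weights vanish on all features up to `m + 1`, then feature `m` is independent
of both the received logit and the label, and every optimal weight for it is zero. -/
theorem optimal_weight_eq_zero {k : ℕ} (hk : 0 < k) (m : Fin k) (hm : m.val + 1 < k)
    {θ : Fin k → ℝ} (hθ : ∀ l : Fin k, l.val ≤ m.val + 1 → θ l = 0) {w v : ℝ}
    (hopt : bceLoss (hardInstance k) (predictor (linearLogit (w • Pi.single m (1 : ℝ) + v • θ)))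
      ≤ bceLoss (hardInstance k)
        (predictor (linearLogit ((0 : ℝ) • Pi.single m (1 : ℝ) + v • θ)))) :
    w = 0 := by
  by_contra hw
  rw [bceLoss_linearLogit hk, bceLoss_linearLogit hk] at hopt
  simp only [map_add, map_smul, zero_smul, zero_add] at hopt
  set a := latentCoeff k (Pi.single m 1) with ha
  set b := latentCoeff k θ with hb
  -- Disjoint supports: `a` vanishes beyond `m`, and `b` vanishes up to `m`.
  have horth : inner ℝ (w • a) (v • b) = 0 := by
    rw [inner_smul_left, inner_smul_right, PiLp.inner_apply, Finset.sum_eq_zero, mul_zero, mul_zero]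
    intro j _
    rcases lt_or_ge m.val j.val with h | h
    · rw [ha, latentCoeff_single_eq_zero m j h, inner_zero_left]
    · rw [hb, latentCoeff_eq_zero hθ j (by omega), inner_zero_right]
  have hnorm : ‖v • b‖ < ‖w • a + v • b‖ := by
    refine lt_of_pow_lt_pow_left₀ 2 (norm_nonneg _) ?_
    have h1 := norm_add_sq_eq_norm_sq_add_norm_sq_real horth
    have h2 : 0 < ‖w • a‖ := norm_pos_iff.2 (smul_ne_zero hw (latentCoeff_single_ne_zero m))
    nlinarith
  have hlast : a ⟨k - 1, by omega⟩ = 0 := latentCoeff_single_eq_zero m _ (by simp; omega)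
  have := gaussianLoss_lt (norm_nonneg _) hnorm
  simp only [latentRisk, PiLp.add_apply, PiLp.smul_apply, hlast, smul_zero, zero_add] at hopt
  linarith

/-- After `i` agents the weight of feature `l` is still zero unless `i > (k - 1 - l) * k + l`:
information travels from the last feature to the earlier ones by one feature per pass. -/
theorem exists_weights_of_isProtocolRun {k : ℕ} (hk : 0 < k) {N : ℕ} {z : ℕ → (Fin k → ℝ) → ℝ}
    (hz : IsProtocolRun (hardInstance k) (cyclicFeatures k hk) pathParents N z) :
    ∀ i ≤ N, ∃ θ : Fin k → ℝ, (i = 0 → θ = 0) ∧ (1 ≤ i → z i = linearLogit θ) ∧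
      ∀ l : Fin k, i ≤ (k - 1 - l.val) * k + l.val → θ l = 0 := by
  intro i
  induction i with
  | zero => exact fun _ => ⟨0, fun _ => rfl, fun h => absurd h (by norm_num), fun _ _ => rfl⟩
  | succ i ih =>
    intro hi
    obtain ⟨θ, h0, h1, hθ⟩ := ih (by omega)
    obtain ⟨hmem, hmin⟩ := hz (i + 1) (by omega) hi
    have hav := mem_availableLogits_path hk i z θ h0 h1
    obtain ⟨w, v, hwv⟩ := (hav _).1 hmem
    refine ⟨_, fun h => absurd h (by omega), fun _ => hwv, fun l hl => ?_⟩
    rw [Pi.add_apply, Pi.smul_apply, Pi.smul_apply, hθ l (by omega), smul_zero, add_zero]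
    rcases eq_or_ne l ⟨i % k, Nat.mod_lt _ hk⟩ with rfl | hne
    · set m : Fin k := ⟨i % k, Nat.mod_lt _ hk⟩ with hm
      have hdiv : k * (i / k) + m.val = i := Nat.div_add_mod i k
      have hq : i / k < k - 1 - m.val := by
        by_contra hcon
        have := Nat.mul_le_mul_left k (not_lt.1 hcon)
        rw [mul_comm (k - 1 - m.val)] at hl
        omega
      have hm1 : 0 < k - 1 - m.val := (Nat.zero_le _).trans_lt hq
      have hw : w = 0 := by
        refine optimal_weight_eq_zero hk m (by omega) (θ := θ) (v := v) (fun l' hl' => ?_)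
          (by rw [← hwv]; exact hmin _ ((hav _).2 ⟨0, v, rfl⟩))
        refine hθ l' ?_
        -- Features `l' ≤ m` have a full pass to spare; `l' = m + 1` has no such slack, but its turn
        -- in the current pass comes after that of `m`.
        rcases hl'.lt_or_eq with h | h
        · have h2 := Nat.mul_le_mul_left k (show i / k + 1 ≤ k - 1 - l'.val by omega)
          have h3 := m.isLt
          rw [mul_comm (k - 1 - l'.val)]
          rw [mul_add] at h2
          omega
        · have h2 := Nat.mul_le_mul_left k (show i / k ≤ k - 1 - l'.val by omega)
          rw [mul_comm (k - 1 - l'.val)]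
          omega
      rw [hw, zero_smul]
    · rw [Pi.single_eq_of_ne hne, smul_zero]

/-! ### The lower bound -/

/-- The other at most `p` coordinates sum to `-a i`, so Cauchy–Schwarz gives `a i ^ 2 ≤ p * (‖a‖ ^ 2
- a i ^ 2)`. -/
theorem apply_le_of_sum_eq_zero {k p : ℕ} (a : EuclideanSpace ℝ (Fin k)) (i : Fin k)
    (s : Finset (Fin k)) (his : i ∉ s) (hs : s.card ≤ p) (hsupp : ∀ j, j ≠ i → j ∉ s → a j = 0)
    (hsum : ∑ j, a j = 0) : a i ≤ ‖a‖ * (1 - 1 / (2 * ((p : ℝ) + 1))) := by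
  have key : ∀ f : Fin k → ℝ, (∀ j, j ≠ i → j ∉ s → f j = 0) → ∑ j, f j = f i + ∑ j ∈ s, f j := by
    intro f hf
    rw [← Finset.sum_insert his]
    refine (Finset.sum_subset (Finset.subset_univ _) fun j _ hj => ?_).symm
    rw [Finset.mem_insert, not_or] at hj
    exact hf j hj.1 hj.2
  have h1 := key (fun j => a j) hsupp
  have h2 := key (fun j => a j ^ 2) fun j hj hj' => by simp [hsupp j hj hj']
  rw [← EuclideanSpace.real_norm_sq_eq] at h2
  have h3 := sq_sum_le_card_mul_sum_sq (s := s) (f := fun j => a j)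
  have h4 : (s.card : ℝ) * ∑ j ∈ s, a j ^ 2 ≤ p * ∑ j ∈ s, a j ^ 2 :=
    mul_le_mul_of_nonneg_right (by exact_mod_cast hs) (Finset.sum_nonneg fun j _ => sq_nonneg _)
  have h5 : ∑ j ∈ s, a j = -a i := by linarith
  rw [h5] at h3
  have hp : (0 : ℝ) < p + 1 := by positivity
  -- Chosen so that `p / (p + 1) = 1 - 2 * η ≤ (1 - η) ^ 2`, which removes the square root.
  set η : ℝ := 1 / (2 * ((p : ℝ) + 1)) with hη
  have hη' : η * (p + 1) = 1 / 2 := by rw [hη]; field_simp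
  have hη0 : 0 < η := by positivity
  have hη1 : η ≤ 1 := by
    rw [hη, div_le_one (by positivity)]
    linarith [Nat.cast_nonneg (α := ℝ) p]
  have h6 : a i ^ 2 * (p + 1) ≤ p * ‖a‖ ^ 2 := by nlinarith
  refine abs_le_of_sq_le_sq' ?_ (mul_nonneg (norm_nonneg a) (sub_nonneg.2 hη1)) |>.2
  have h7 : a i ^ 2 ≤ (1 - 2 * η) * ‖a‖ ^ 2 := by
    have : a i ^ 2 * (p + 1) * (2 * η) ≤ p * ‖a‖ ^ 2 * (2 * η) :=
      mul_le_mul_of_nonneg_right h6 (by positivity)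
    have h8 : (p : ℝ) * (2 * η) = 1 - 2 * η := by linarith
    nlinarith
  nlinarith [mul_nonneg (sq_nonneg η) (sq_nonneg ‖a‖)]

/-- After `p` passes the excess loss is at least of order `1 / p`. -/
theorem exists_excess_loss_lower_bound :
    ∃ c : ℝ, 0 < c ∧ ∀ (k : ℕ) (hk : 0 < k) (p : ℕ), 1 ≤ p → p ≤ k - 1 →
      ∀ (θ : Fin k → ℝ) (z : ℕ → (Fin k → ℝ) → ℝ), IsGlobalOptimum (hardInstance k) θ →
        IsProtocolRun (hardInstance k) (cyclicFeatures k hk) pathParents (k * p) z →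
        c * (1 / (p : ℝ)) ≤ bceLoss (hardInstance k) (predictor (z (k * p)))
          - bceLoss (hardInstance k) (predictor (linearLogit θ)) := by
  obtain ⟨δ, hδ, hbound⟩ := exists_excess_lower_bound
  -- The factor `4` absorbs `2 * (p + 1) ≤ 4 * p`.
  refine ⟨δ / 4, by positivity, fun k hk p hp hpk θ z hθ hz => ?_⟩
  obtain ⟨t, -, ht, htz⟩ := exists_weights_of_isProtocolRun hk hz (k * p) le_rfl
  rw [ht (Nat.mul_pos hk hp)]
  set i : Fin k := ⟨k - 1, by omega⟩ with hi
  have hzero : ∀ l : Fin k, l.val ≤ k - 1 - p → t l = 0 := by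
    intro l hl
    refine htz l ?_
    have := Nat.mul_le_mul_left k (show p ≤ k - 1 - l.val by omega)
    rw [mul_comm (k - 1 - l.val)]
    omega
  have hp0 : (1 : ℝ) ≤ p := by exact_mod_cast hp
  have hcoef : latentCoeff k t i ≤ ‖latentCoeff k t‖ * (1 - 1 / (2 * ((p : ℝ) + 1))) := by
    refine apply_le_of_sum_eq_zero _ i (Finset.Ico ⟨k - 1 - p, by omega⟩ i)
      (by simp) (by simp [hi]; omega) (fun j hj hj' => ?_) ?_
    · refine latentCoeff_eq_zero hzero j ?_
      have h1 : j.val ≠ k - 1 := fun h => hj (Fin.ext h)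
      simp only [Finset.mem_Ico, Fin.le_def, Fin.lt_def, hi] at hj'
      omega
    · rw [sum_latentCoeff hk]
      exact hzero _ (by simp)
  have h := hbound (1 / (2 * ((p : ℝ) + 1)))
    (bceLoss (hardInstance k) (predictor (linearLogit θ))) ‖latentCoeff k t‖ (latentCoeff k t i)
    (norm_nonneg _) (by positivity) (by rw [div_le_one (by positivity)]; linarith) hcoef
    fun s hs => ?_
  · rw [bceLoss_linearLogit hk t]
    refine le_trans ?_ h
    rw [mul_one_div, mul_one_div, div_div]
    refine div_le_div_of_nonneg_left hδ.le (by positivity) (by linarith)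
  -- Equal weights `s` telescope to `s` times the last latent variable, so the global optimum is at
  -- least as good as every pure rescaling of the signal.
  · refine (hθ fun _ => s).trans_eq ?_
    have hs' : latentCoeff k (fun _ => s) = EuclideanSpace.single i s := by
      ext j
      rw [latentCoeff_apply, PiLp.single_apply]
      have : j = i ↔ ¬ (j.val + 1 < k) := by
        rw [Fin.ext_iff, hi]
        constructor <;> intro h <;> simp at * <;> omega
      by_cases h : j.val + 1 < k <;> simp [this, h]
    rw [bceLoss_linearLogit hk, hs', latentRisk, PiLp.norm_single, Real.norm_eq_abs,
      abs_of_nonneg hs]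
    simp [hi]

end

end NetLogistic

theorem mainTheorem2 :
    -- Some universal constant `c` works for all dimensions `k` and all passes `p ≤ k - 1`.
    ∃ c : ℝ, 0 < c ∧ ∀ (k : ℕ) (hk : 2 ≤ k) (p : ℕ), 1 ≤ p → p ≤ k - 1 →
      ∀ D : ℕ, D = k * p →
        -- The global optimum and the outputs of the agents on the path exist,
        (∃ θ : Fin k → ℝ, NetLogistic.IsGlobalOptimum (NetLogistic.hardInstance k) θ) ∧
        (∃ z : ℕ → (Fin k → ℝ) → ℝ,
          NetLogistic.IsProtocolRun (NetLogistic.hardInstance k)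
            (NetLogistic.cyclicFeatures k (by omega)) NetLogistic.pathParents D z) ∧
        -- and the final agent's excess loss is at least `c / p = c * (k / D)`.
        ∀ (θ : Fin k → ℝ) (z : ℕ → (Fin k → ℝ) → ℝ),
          NetLogistic.IsGlobalOptimum (NetLogistic.hardInstance k) θ →
          NetLogistic.IsProtocolRun (NetLogistic.hardInstance k)
            (NetLogistic.cyclicFeatures k (by omega)) NetLogistic.pathParents D z →
          c * (1 / (p : ℝ)) ≤
              NetLogistic.bceLoss (NetLogistic.hardInstance k) (NetLogistic.predictor (z D)) -
              NetLogistic.bceLoss (NetLogistic.hardInstance k)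
                (NetLogistic.predictor (NetLogistic.linearLogit θ)) ∧
          c * ((k : ℝ) / (D : ℝ)) ≤
              NetLogistic.bceLoss (NetLogistic.hardInstance k) (NetLogistic.predictor (z D)) -
              NetLogistic.bceLoss (NetLogistic.hardInstance k)
                (NetLogistic.predictor (NetLogistic.linearLogit θ)) := by
  obtain ⟨c, hc, h⟩ := NetLogistic.exists_excess_loss_lower_bound
  refine ⟨c, hc, fun k hk p hp hpk D hD => ?_⟩
  have hk0 : 0 < k := by omega
  subst hD
  refine ⟨NetLogistic.exists_isGlobalOptimum hk0, NetLogistic.exists_isProtocolRun hk0 _,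
    fun θ z hθ hz => ?_⟩
  have hmain := h k hk0 p hp hpk θ z hθ hz
  have hkD : (k : ℝ) / ((k * p : ℕ) : ℝ) = 1 / (p : ℝ) := by
    have : (k : ℝ) ≠ 0 := by positivity
    push_cast
    field_simp
  exact ⟨hmain, hkD ▸ hmain⟩
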